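/- Let $F$ be an oriented punctured surface with an ideal triangulation $\Delta$, i.e. a finite collection of arcs decomposing $F$ into triangles with their vertices at the punctures (two sides of one triangle may be identified in $F$). A decorated measured lamination $\mathcal L$ of $F$ consists of a (possibly empty) measured lamination $\mathcal L_0$ with compact support in $F$ and without puncture-parallel leaves, in tight position with respect to $\Delta$ (it meets each triangle in pairwise disjoint arcs that join distinct sides), together with a real number $d_p$, of arbitrary sign, for each puncture $p$, regarded as the total weight of the collar curves (curves parallel to the puncture) at $p$. The leaves of $\mathcal L$ are the leaves of $\mathcal L_0$ and the collar curves at the punctures $p$ with $d_p\neq 0$. The measure of $\mathcal L$ with respect to $\Delta$ is the function $\mu:\Delta\to\mathbb R$ that assigns to an arc $e$ with ends at the (possibly equal) punctures $p$ and $q$ the number $\mathcal L_0(e)+d_p+d_q$, where $\mathcal L_0(e)$ is the total transverse measure of $e$. Suppose that $\mu:\Delta\to\mathbb R$ is the measure of a decorated measured lamination $\mathcal L$ with respect to some ideal triangulation $\Delta$ of $F$, and that $\mu$ satisfies the tropical triangle inequalities: for every triangle complementary to $\Delta$ with frontier edges $a,b,c$, $$\mu(a)\le\max\{\mu(b),\mu(c)\},\qquad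 \mu(b)\le\max\{\mu(a),\mu(c)\},\qquad \mu(c)\le\max\{\mu(a),\mu(b)\}.$$ Then every leaf of $\mathcal L$ is a simple closed curve in $F$. -/

import Mathlib

open Set MeasureTheory

noncomputable section

/-- The standard closed triangle, in barycentric coordinates, with its three vertices removed. -/
def IdealTriangle : Type :=
  {x : Fin 3 → ℝ // (∀ i, 0 ≤ x i) ∧ ∑ i, x i = 1 ∧ ∀ i, x i < 1}

instance : TopologicalSpace IdealTriangle := instTopologicalSpaceSubtype

/-- The sides of a triangle are numbered by the opposite vertices, so that side `i` runs from the
vertex `i + 1` (at `u = 0`) to the vertex `i + 2` (at `u = 1`).  This is its point of parameter `u`.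
All three sides are traversed in the boundary orientation. -/
def sidePoint (i : Fin 3) (u : ℝ) : Fin 3 → ℝ :=
  fun j => if j = i then 0 else if j = i + 1 then 1 - u else u

/-- The straight chord that cuts off the vertex `k` of a triangle: it joins the point at distance
`a.1` from the vertex on the side that leaves the vertex (side `k + 2`) to the point at distance
`a.2` from the vertex on the side that enters it (side `k + 1`). -/
def chord (k : Fin 3) (a : ℝ × ℝ) : Set (Fin 3 → ℝ) :=
  segment ℝ (sidePoint (k + 2) a.1) (sidePoint (k + 1) (1 - a.2))

/-- An ideal triangulation of a punctured oriented surface `F`: a decomposition of `F` into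
finitely many triangles with their vertices at the punctures (so that the vertices are missing).
The surface is displayed as the quotient of a disjoint union of triangles without vertices, whose
sides are glued in pairs by orientation reversing maps.  Two sides of one triangle may be
glued together. -/
structure IdealTriangulation (F : Type*) [TopologicalSpace F] where
  /-- the number of complementary triangles -/
  n : ℕ
  /-- the pairing of the sides; `(t, i)` is the side `i` of the triangle `t` -/
  glue : Fin n × Fin 3 → Fin n × Fin 3
  glue_glue : ∀ s, glue (glue s) = s
  glue_ne : ∀ s, glue s ≠ s
  /-- the characteristic maps of all triangles together -/
  proj : Fin n × IdealTriangle → F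
  isQuotientMap_proj : Topology.IsQuotientMap proj
  proj_eq_iff : ∀ p q, proj p = proj q ↔ p = q ∨
    ∃ (s : Fin n × Fin 3) (u : ℝ), p.1 = s.1 ∧ p.2.1 = sidePoint s.2 u ∧
      q.1 = (glue s).1 ∧ q.2.1 = sidePoint (glue s).2 (1 - u)

namespace IdealTriangulation

variable {F : Type*} [TopologicalSpace F] (D : IdealTriangulation F)

/-- A side of a triangle. -/
abbrev Side : Type := Fin D.n × Fin 3

/-- A corner of a triangle: `(t, k)` is the corner of the triangle `t` at its vertex `k`. -/
abbrev Corner : Type := Fin D.n × Fin 3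

/-- The set of arcs of the ideal triangulation: sides, up to gluing. -/
def Edge : Type := Quot (fun s s' : D.Side => s' = D.glue s)

/-- The arc of the triangulation on which a side lies. -/
def edge (s : D.Side) : D.Edge := Quot.mk _ s

/-- The corner that follows a given one around a puncture: cross the side that enters the
corner's vertex. -/
def turn (c : D.Corner) : D.Corner :=
  ((D.glue (c.1, c.2 + 1)).1, (D.glue (c.1, c.2 + 1)).2 + 1)

/-- The punctures of `F`: the cycles of corners. -/
def Puncture : Type := Quot (fun c c' : D.Corner => c' = D.turn c)

/-- The puncture at which a corner lies. -/
def puncture (c : D.Corner) : D.Puncture := Quot.mk _ c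

/-- The puncture from which a side starts. -/
def source (s : D.Side) : D.Puncture := D.puncture (s.1, s.2 + 1)

/-- The puncture at which a side ends. -/
def target (s : D.Side) : D.Puncture := D.puncture (s.1, s.2 + 2)

theorem source_glue (s : D.Side) : D.source (D.glue s) = D.target s := by
  obtain ⟨t, i⟩ := s
  have h : i + 2 + 1 = i := by fin_cases i <;> rfl
  symm
  apply Quot.sound
  simp only [turn, h]

theorem target_glue (s : D.Side) : D.target (D.glue s) = D.source s := by
  rw [← D.source_glue, D.glue_glue]

/-- The image in `F` of a chord that cuts off the corner `c`. -/
def arc (c : D.Corner) (a : ℝ × ℝ) : Set F :=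
  D.proj '' {p | p.1 = c.1 ∧ p.2.1 ∈ chord c.2 a}

/-- The tropical triangle inequalities for a weight on the arcs of the triangulation. -/
def TropicalTriangle (μ : D.Edge → ℝ) : Prop :=
  ∀ (t : Fin D.n) (i : Fin 3),
    μ (D.edge (t, i)) ≤ max (μ (D.edge (t, i + 1))) (μ (D.edge (t, i + 2)))

/-- A collar curve: the closed curve parallel to the puncture `p` that crosses, at distance `u`
from `p`, every end at `p` of an arc of the triangulation. -/
def collar (p : D.Puncture) (u : ℝ) : Set F :=
  ⋃ (c : D.Corner) (_ : D.puncture c = p), D.arc c (u, u)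

/-- A measured lamination with compact support in `F`, in tight position with respect to the
ideal triangulation: it meets every triangle in pairwise disjoint straight chords that join
distinct sides, which fit together along the arcs of the triangulation, and it has an invariant
transverse measure of full support.  Any lamination that meets every triangle in arcs that join
distinct sides becomes straight after an isotopy that fixes the arcs of the triangulation.
Leaves may be isolated (they then carry an atom of the transverse measure), come in foliated bands,
or be locally Cantor-like. -/
structure MeasuredLamination where
  /-- the chords of the lamination that cut off a corner -/
  chords : D.Corner → Set (ℝ × ℝ)
  isCompact_chords : ∀ c, IsCompact (chords c)
  chords_subset : ∀ c, chords c ⊆ Ioo 0 1 ×ˢ Ioo 0 1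
  disjoint_chords : ∀ (t : Fin D.n) (k k' : Fin 3) (a a' : ℝ × ℝ),
    a ∈ chords (t, k) → a' ∈ chords (t, k') → (k, a) ≠ (k', a') →
      Disjoint (chord k a) (chord k' a')
  /-- the intersection of the lamination with a side -/
  trace : D.Side → Set ℝ
  trace_eq : ∀ s, trace s =
    (fun a => a.1) '' chords (s.1, s.2 + 1) ∪ (fun a => 1 - a.2) '' chords (s.1, s.2 + 2)
  /-- leaves continue across the arcs of the triangulation -/
  trace_glue : ∀ s, trace (D.glue s) = (fun u => 1 - u) '' trace s
  /-- the transverse measure on a side -/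
  mass : D.Side → Measure ℝ
  finite_mass : ∀ s, IsFiniteMeasure (mass s)
  support_mass : ∀ s, (mass s).support = trace s
  mass_glue : ∀ s, mass (D.glue s) = (mass s).map (fun u => 1 - u)
  /-- the transverse measure is invariant under sliding along the chords of a triangle -/
  mass_chords : ∀ (t : Fin D.n) (k : Fin 3) (A : Set (ℝ × ℝ)),
    A ⊆ chords (t, k) → MeasurableSet A →
      mass (t, k + 2) ((fun a => a.1) '' A) = mass (t, k + 1) ((fun a => 1 - a.2) '' A)

namespace MeasuredLamination

variable {D} (L : D.MeasuredLamination)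

/-- The support of the lamination, a subset of `F`. -/
def carrier : Set F := ⋃ (c : D.Corner) (a ∈ L.chords c), D.arc c a

/-- Two points lie on a common chord of the lamination. -/
def OnArc (x y : F) : Prop := ∃ (c : D.Corner), ∃ a ∈ L.chords c, x ∈ D.arc c a ∧ y ∈ D.arc c a

/-- `S` is a leaf: the set of points that can be reached from some point of the lamination by
following finitely many consecutive chords. -/
def IsLeaf (S : Set F) : Prop :=
  ∃ x ∈ L.carrier, S = {y | Relation.ReflTransGen L.OnArc x y}

/-- `S` is a puncture-parallel leaf: it cuts off, once each, the corners at one puncture. -/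
def IsPunctureParallelLeaf (S : Set F) : Prop :=
  L.IsLeaf S ∧ ∃ (p : D.Puncture) (a : D.Corner → ℝ × ℝ),
    (∀ c, D.puncture c = p → a c ∈ L.chords c) ∧
      S = ⋃ (c : D.Corner) (_ : D.puncture c = p), D.arc c (a c)

end MeasuredLamination

/-- A decorated measured lamination: a measured lamination with compact support without
puncture-parallel leaves, together with a real number for each puncture, the (possibly negative)
total weight of the collar curves at that puncture. -/
structure DecoratedMeasuredLamination extends D.MeasuredLamination where
  not_punctureParallel : ∀ S, ¬ toMeasuredLamination.IsPunctureParallelLeaf S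
  /-- the decoration -/
  decoration : D.Puncture → ℝ

namespace DecoratedMeasuredLamination

variable {D} (L : D.DecoratedMeasuredLamination)

/-- The measure of a decorated measured lamination on the arcs of the ideal triangulation: the
transverse measure of the arc, to which the collar curves at the two ends of the arc contribute
the decorations. -/
def measure : D.Edge → ℝ :=
  Quot.lift (fun s => (L.mass s).real univ + L.decoration (D.source s)
      + L.decoration (D.target s)) (by
    rintro s _ rfl
    have h : (L.mass (D.glue s)).real univ = (L.mass s).real univ := by
      rw [L.mass_glue, Measure.real, Measure.real,
        Measure.map_apply (by fun_prop) MeasurableSet.univ, preimage_univ]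
    simp only [h, D.source_glue, D.target_glue]
    ring)

/-- The leaves of a decorated measured lamination: the leaves of the underlying measured
lamination, and the collar curves at the punctures with nonzero decoration, drawn so close to the
punctures that they are disjoint from one another and from the other leaves. -/
def IsLeaf (S : Set F) : Prop :=
  L.toMeasuredLamination.IsLeaf S ∨
    ∃ (p : D.Puncture) (u : ℝ), L.decoration p ≠ 0 ∧ u ∈ Ioo 0 (1 / 2) ∧ S = D.collar p u ∧
      Disjoint S L.carrier

end DecoratedMeasuredLamination

end IdealTriangulation

/-- A simple closed curve: the image of the circle under a continuous injective map. -/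
def IsSimpleClosedCurve {F : Type*} [TopologicalSpace F] (S : Set F) : Prop :=
  ∃ γ : Circle → F, Continuous γ ∧ Function.Injective γ ∧ range γ = S

end

/-!
Give each point `x` of the lamination on an arc of the triangulation the two weighted distances
`depth x` and `depth (flip x)` from the ends of the arc: the decoration of the puncture at that end
plus the transverse measure in between, half of an atom at `x` included. Their sum is the measure
`μ` of the arc. The point is that their minimum, `height x`, is constant along every leaf. A chord
that cuts off a corner at a puncture `p` preserves the weighted distance `d` from `p`. If the two
arcs that it joins have the same measure, then it preserves the other weighted distance, too. If
not, write `μ` as the sum of the weights of the two adjacent corners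
(`DecoratedMeasuredLamination.measure_edge`): the tropical triangle inequalities say that the
smallest of the three corner weights of a triangle is attained at least twice, so the corner that
is cut off has the smallest weight, `d` is bounded by this weight, and `d` is the minimum at both
ends (`DecoratedMeasuredLamination.height_eq`).

Since the transverse measure has full support, at most two points of the lamination on a given side
have a given `depth`, so that every level of `height` is finite
(`DecoratedMeasuredLamination.finite_height_eq`), and every leaf consists of finitely many chords.
Going along the leaf permutes these chords with a direction. This permutation is the composition of
two involutions without fixed points, so that no chord is run through in both directions
(`MeasuredLamination.DirectedChord.reverse_next_zpow_ne`), and the chords of the leaf form a closed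
chain of pairwise disjoint segments. Such a chain is a simple closed curve
(`Crossing.isSimpleClosedCurve_cycle`). The same holds for the collar curves, whose chords are
permuted by the rotation of the corners around the puncture.
-/

/-! ### Straight crossings of a triangle -/

theorem sidePoint_self (i : Fin 3) (u : ℝ) : sidePoint i u i = 0 := by
  simp [sidePoint]

theorem sidePoint_add_one (i : Fin 3) (u : ℝ) : sidePoint i u (i + 1) = 1 - u := by
  fin_cases i <;> simp [sidePoint]

theorem sidePoint_add_two (i : Fin 3) (u : ℝ) : sidePoint i u (i + 2) = u := by
  fin_cases i <;> simp [sidePoint]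

theorem sum_sidePoint (i : Fin 3) (u : ℝ) : ∑ j, sidePoint i u j = 1 := by
  fin_cases i <;> simp [sidePoint, Fin.sum_univ_three]

theorem sidePoint_pos {i j : Fin 3} (h : j ≠ i) {u : ℝ} (hu : u ∈ Ioo (0 : ℝ) 1) :
    0 < sidePoint i u j := by
  rw [sidePoint, if_neg h]
  split_ifs
  · linarith [hu.2]
  · exact hu.1

theorem sidePoint_nonneg (i j : Fin 3) {u : ℝ} (hu : u ∈ Ioo (0 : ℝ) 1) :
    0 ≤ sidePoint i u j := by
  rcases eq_or_ne j i with rfl | h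
  · rw [sidePoint_self]
  · exact (sidePoint_pos h hu).le

theorem sidePoint_lt_one (i j : Fin 3) {u : ℝ} (hu : u ∈ Ioo (0 : ℝ) 1) :
    sidePoint i u j < 1 := by
  unfold sidePoint
  split_ifs
  · exact zero_lt_one
  · linarith [hu.1]
  · exact hu.2

theorem eq_of_sidePoint_eq {i i' : Fin 3} {u u' : ℝ} (hu : u ∈ Ioo (0 : ℝ) 1)
    (h : sidePoint i u = sidePoint i' u') : i = i' ∧ u = u' := by
  have hi : i = i' := by
    by_contra hne
    have := sidePoint_pos (Ne.symm hne) hu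
    rw [h, sidePoint_self] at this
    exact lt_irrefl _ this
  subst hi
  refine ⟨rfl, ?_⟩
  rw [← sidePoint_add_two i u, h, sidePoint_add_two]

namespace IdealTriangulation

variable {F : Type*} [TopologicalSpace F] (D : IdealTriangulation F)

/-- A directed straight segment in a triangle of an ideal triangulation, which joins interior points
of distinct sides: it runs from the point of parameter `u` of the side `i` of the triangle `t` to
the point of parameter `v` of the side `j`. -/
structure Crossing where
  t : Fin D.n
  i : Fin 3
  j : Fin 3
  u : ℝ
  v : ℝ
  ne : i ≠ j
  hu : u ∈ Ioo (0 : ℝ) 1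
  hv : v ∈ Ioo (0 : ℝ) 1

variable {D}

/-- The identification of the points of the sides, given by side and parameter, by the gluing. -/
def flip (x : D.Side × ℝ) : D.Side × ℝ := (D.glue x.1, 1 - x.2)

@[simp]
theorem flip_flip (x : D.Side × ℝ) : flip (flip x) = x := by
  simp [flip, D.glue_glue]

theorem flip_ne (x : D.Side × ℝ) : flip x ≠ x := fun h => D.glue_ne x.1 (congrArg Prod.fst h)

namespace Crossing

/-- The point of the boundary of the triangle at which a crossing starts. -/
def start (C : D.Crossing) : D.Side × ℝ := ((C.t, C.i), C.u)

/-- The point of the boundary of the triangle at which a crossing ends. -/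
def finish (C : D.Crossing) : D.Side × ℝ := ((C.t, C.j), C.v)

/-- The crossing run through in the opposite direction. -/
@[simps]
def reverse (C : D.Crossing) : D.Crossing := ⟨C.t, C.j, C.i, C.v, C.u, C.ne.symm, C.hv, C.hu⟩

theorem start_ne_finish (C : D.Crossing) : C.start ≠ C.finish := fun h =>
  C.ne (congrArg (fun x => x.1.2) h)

/-- The segment of a crossing, in barycentric coordinates. -/
def seg (C : D.Crossing) : Set (Fin 3 → ℝ) := segment ℝ (sidePoint C.i C.u) (sidePoint C.j C.v)

/-- The image of a crossing in the surface. -/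
def image (C : D.Crossing) : Set F := D.proj '' {p | p.1 = C.t ∧ p.2.1 ∈ C.seg}

@[simp]
theorem seg_reverse (C : D.Crossing) : C.reverse.seg = C.seg := segment_symm ..

@[simp]
theorem image_reverse (C : D.Crossing) : C.reverse.image = C.image := by
  simp [image]

theorem seg_subset (C : D.Crossing) {x : Fin 3 → ℝ} (hx : x ∈ C.seg) :
    (∀ i, 0 ≤ x i) ∧ ∑ i, x i = 1 ∧ ∀ i, x i < 1 := by
  obtain ⟨a, b, ha, hb, hab, rfl⟩ := hx
  refine ⟨fun k => ?_, ?_, fun k => ?_⟩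
  · have h1 := sidePoint_nonneg C.i k C.hu
    have h2 := sidePoint_nonneg C.j k C.hv
    simp only [Pi.add_apply, Pi.smul_apply, smul_eq_mul]
    positivity
  · simp only [Pi.add_apply, Pi.smul_apply, smul_eq_mul, Finset.sum_add_distrib,
      ← Finset.mul_sum, sum_sidePoint, mul_one, hab]
  · exact convex_Iio (1 : ℝ) (sidePoint_lt_one C.i k C.hu) (sidePoint_lt_one C.j k C.hv) ha hb hab

/-- The affine parametrization of a crossing, constant outside of the unit interval. -/
noncomputable def point (C : D.Crossing) (r : ℝ) : IdealTriangle :=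
  ⟨AffineMap.lineMap (sidePoint C.i C.u) (sidePoint C.j C.v) (projIcc 0 1 zero_le_one r : ℝ),
    C.seg_subset (by
      rw [seg, segment_eq_image_lineMap]
      exact mem_image_of_mem _ (projIcc 0 1 zero_le_one r).2)⟩

theorem point_val (C : D.Crossing) {r : ℝ} (hr : r ∈ Icc (0 : ℝ) 1) :
    (C.point r).1 = AffineMap.lineMap (sidePoint C.i C.u) (sidePoint C.j C.v) r := by
  simp [point, projIcc_of_mem zero_le_one hr]

theorem continuous_point (C : D.Crossing) : Continuous C.point := by
  refine Continuous.subtype_mk ?_ _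
  have h : Continuous fun r : ℝ => ((projIcc 0 1 zero_le_one r : Icc (0 : ℝ) 1) : ℝ) :=
    continuous_subtype_val.comp continuous_projIcc
  exact AffineMap.lineMap_continuous.comp h

theorem point_zero (C : D.Crossing) : (C.point 0).1 = sidePoint C.i C.u := by
  rw [C.point_val (by simp), AffineMap.lineMap_apply_zero]

theorem point_one (C : D.Crossing) : (C.point 1).1 = sidePoint C.j C.v := by
  rw [C.point_val (by simp), AffineMap.lineMap_apply_one]

theorem point_mem_seg (C : D.Crossing) {r : ℝ} (hr : r ∈ Icc (0 : ℝ) 1) :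
    (C.point r).1 ∈ C.seg := by
  rw [seg, segment_eq_image_lineMap, C.point_val hr]
  exact mem_image_of_mem _ hr

theorem point_injOn (C : D.Crossing) : InjOn C.point (Icc 0 1) := by
  intro r hr r' hr' h
  have h' := congrArg Subtype.val h
  rw [C.point_val hr, C.point_val hr'] at h'
  refine AffineMap.lineMap_injective ℝ ?_ h'
  exact fun h => C.ne (eq_of_sidePoint_eq C.hu h).1

theorem image_eq (C : D.Crossing) :
    C.image = (fun r => D.proj (C.t, C.point r)) '' Icc (0 : ℝ) 1 := by
  ext z
  constructor
  · rintro ⟨⟨t, p⟩, ⟨rfl, hp⟩, rfl⟩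
    simp only [seg, segment_eq_image_lineMap] at hp
    obtain ⟨r, hr, h⟩ := hp
    refine ⟨r, hr, ?_⟩
    have : C.point r = p := Subtype.ext ((C.point_val hr).trans h)
    simp only [this]
  · rintro ⟨r, hr, rfl⟩
    exact ⟨_, ⟨rfl, C.point_mem_seg hr⟩, rfl⟩

/-- A crossing meets the boundary of its triangle in its two ends only. -/
theorem eq_start_or_finish (C : D.Crossing) {r : ℝ} (hr : r ∈ Icc (0 : ℝ) 1) {i : Fin 3} {u : ℝ}
    (h : (C.point r).1 = sidePoint i u) :
    (r = 0 ∧ ((C.t, i), u) = C.start) ∨ (r = 1 ∧ ((C.t, i), u) = C.finish) := by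
  rcases eq_or_ne r 0 with rfl | h0
  · rw [C.point_zero] at h
    obtain ⟨rfl, rfl⟩ := eq_of_sidePoint_eq C.hu h
    exact Or.inl ⟨rfl, rfl⟩
  rcases eq_or_ne r 1 with rfl | h1
  · rw [C.point_one] at h
    obtain ⟨rfl, rfl⟩ := eq_of_sidePoint_eq C.hv h
    exact Or.inr ⟨rfl, rfl⟩
  exfalso
  have h0 : 0 < r := lt_of_le_of_ne hr.1 h0.symm
  have h1 : 0 < 1 - r := sub_pos.2 (lt_of_le_of_ne hr.2 h1)
  have hz := congrFun h i
  rw [C.point_val hr, sidePoint_self, AffineMap.lineMap_apply_module] at hz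
  simp only [Pi.add_apply, Pi.smul_apply, smul_eq_mul] at hz
  have p1 := mul_nonneg h1.le (sidePoint_nonneg C.i i C.hu)
  have p2 := mul_nonneg h0.le (sidePoint_nonneg C.j i C.hv)
  rcases eq_or_ne i C.i with rfl | hi
  · linarith [mul_pos h0 (sidePoint_pos C.ne C.hv)]
  · linarith [mul_pos h1 (sidePoint_pos hi C.hu)]

/-- Two crossings meet in the surface either inside of a triangle or in glued ends. -/
theorem proj_point_eq {C C' : D.Crossing} {r r' : ℝ} (hr : r ∈ Icc (0 : ℝ) 1)
    (hr' : r' ∈ Icc (0 : ℝ) 1) (h : D.proj (C.t, C.point r) = D.proj (C'.t, C'.point r')) :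
    (C.t = C'.t ∧ C.point r = C'.point r') ∨
      ∃ x, ((r = 0 ∧ x = C.start) ∨ (r = 1 ∧ x = C.finish)) ∧
        ((r' = 0 ∧ flip x = C'.start) ∨ (r' = 1 ∧ flip x = C'.finish)) := by
  rcases (D.proj_eq_iff _ _).1 h with h | ⟨⟨t, i⟩, u, rfl, h2, h3, h4⟩
  · exact Or.inl ⟨congrArg Prod.fst h, congrArg Prod.snd h⟩
  · refine Or.inr ⟨_, C.eq_start_or_finish hr h2, ?_⟩
    have h3 : C'.t = (D.glue (C.t, i)).1 := h3
    have := C'.eq_start_or_finish hr' h4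
    rwa [h3] at this

theorem proj_eq_of_flip_eq {C C' : D.Crossing} (h : flip C.finish = C'.start) :
    D.proj (C.t, C.point 1) = D.proj (C'.t, C'.point 0) := by
  refine (D.proj_eq_iff _ _).2 (Or.inr ⟨C.finish.1, C.finish.2, rfl, C.point_one, ?_, ?_⟩)
  · exact (congrArg (fun x => x.1.1) h).symm
  · have h1 : (D.glue C.finish.1).2 = C'.i := congrArg (fun x => x.1.2) h
    have h2 : 1 - C.finish.2 = C'.u := congrArg (fun x => x.2) h
    rw [h1, h2, C'.point_zero]

end Crossing

end IdealTriangulation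

/-! ### Closed chains of crossings -/

/-- The image of an injective closed curve, parametrized by the line with period `T`, is a simple
closed curve. -/
theorem isSimpleClosedCurve_range {F : Type*} [TopologicalSpace F] {T : ℝ} (hT : T ≠ 0)
    {γ : ℝ → F} (hγ : Continuous γ) (hper : Function.Periodic γ T)
    (hinj : ∀ x y, γ x = γ y → ∃ n : ℤ, x - y = n * T) : IsSimpleClosedCurve (range γ) := by
  have hcont : Continuous hper.lift := hγ.quotient_lift _
  have hlift : Function.Injective hper.lift := by
    intro p q
    induction p using QuotientAddGroup.induction_on with | H x => ?_
    induction q using QuotientAddGroup.induction_on with | H y => ?_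
    intro h
    obtain ⟨n, hn⟩ := hinj x y h
    refine (QuotientAddGroup.eq_iff_sub_mem).2 ?_
    rw [hn, AddSubgroup.mem_zmultiples_iff]
    exact ⟨n, by simp⟩
  let e := (AddCircle.homeomorphCircle hT).symm
  refine ⟨hper.lift ∘ e, hcont.comp e.continuous, hlift.comp e.injective, ?_⟩
  rw [e.surjective.range_comp]
  ext z
  constructor
  · rintro ⟨p, rfl⟩
    induction p using QuotientAddGroup.induction_on with | H x => ?_
    exact ⟨x, rfl⟩
  · rintro ⟨x, rfl⟩
    exact ⟨(x : AddCircle T), rfl⟩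

namespace IdealTriangulation

variable {F : Type*} [TopologicalSpace F] {D : IdealTriangulation F}

namespace Crossing

/-- The curve that runs through a chain of crossings, one in each unit of time. -/
noncomputable def chain (C : ℤ → D.Crossing) (x : ℝ) : F :=
  D.proj ((C ⌊x⌋).t, (C ⌊x⌋).point (Int.fract x))

theorem chain_eq {C : ℤ → D.Crossing} (hglue : ∀ i, flip (C i).finish = (C (i + 1)).start) {i : ℤ}
    {x : ℝ} (hx : x ∈ Icc (i : ℝ) (i + 1)) :
    chain C x = D.proj ((C i).t, (C i).point (x - i)) := by
  rcases eq_or_lt_of_le hx.2 with rfl | h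
  · have h1 : ⌊(i : ℝ) + 1⌋ = i + 1 := by simp
    have h2 : Int.fract ((i : ℝ) + 1) = 0 := by simp
    rw [chain, h1, h2, ← proj_eq_of_flip_eq (hglue i), add_sub_cancel_left]
  · have h1 : ⌊x⌋ = i := Int.floor_eq_iff.2 ⟨hx.1, h⟩
    rw [chain, Int.fract, h1]

theorem continuous_chain {C : ℤ → D.Crossing}
    (hglue : ∀ i, flip (C i).finish = (C (i + 1)).start) : Continuous (chain C) := by
  have hfin : LocallyFinite fun i : ℤ => Icc (i : ℝ) (i + 1) :=
    locallyFinite_Icc_of_tendsto tendsto_intCast_atTop_atTop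
      (Filter.tendsto_atBot_add_const_right _ _ ((tendsto_intCast_atBot_iff.2 Filter.tendsto_id)))
  refine hfin.continuous ?_ (fun i => isClosed_Icc) fun i => ?_
  · exact eq_univ_of_forall fun x =>
      mem_iUnion.2 ⟨⌊x⌋, Int.floor_le x, (Int.lt_floor_add_one x).le⟩
  · refine ContinuousOn.congr (Continuous.continuousOn ?_) fun x hx => chain_eq hglue hx
    exact D.isQuotientMap_proj.continuous.comp
      (continuous_const.prodMk ((C i).continuous_point.comp (continuous_id.sub continuous_const)))

theorem range_chain {C : ℤ → D.Crossing} (hglue : ∀ i, flip (C i).finish = (C (i + 1)).start) :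
    range (chain C) = ⋃ i, (C i).image := by
  simp only [image_eq]
  ext z
  simp only [mem_range, mem_iUnion]
  constructor
  · rintro ⟨x, rfl⟩
    exact ⟨⌊x⌋, Int.fract x, ⟨Int.fract_nonneg x, (Int.fract_lt_one x).le⟩, rfl⟩
  · rintro ⟨i, r, hr, rfl⟩
    refine ⟨i + r, ?_⟩
    rw [chain_eq hglue (i := i) ⟨by linarith [hr.1], by linarith [hr.2]⟩, add_sub_cancel_left]

/-- A closed chain of pairwise disjoint crossings is a simple closed curve. -/
theorem isSimpleClosedCurve_chain {C : ℤ → D.Crossing} {N : ℕ} (hN : N ≠ 0)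
    (hper : ∀ i, C (i + N) = C i) (hglue : ∀ i, flip (C i).finish = (C (i + 1)).start)
    (hdisj : ∀ i j, ¬ (N : ℤ) ∣ i - j → (C i).t = (C j).t → Disjoint (C i).seg (C j).seg) :
    IsSimpleClosedCurve (⋃ i, (C i).image) := by
  rw [← range_chain hglue]
  refine isSimpleClosedCurve_range (T := N) (by exact_mod_cast hN) (continuous_chain hglue) ?_ ?_
  · intro x
    simp [chain, hper]
  intro x y hxy
  have hx : Int.fract x ∈ Icc (0 : ℝ) 1 := ⟨Int.fract_nonneg x, (Int.fract_lt_one x).le⟩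
  have hy : Int.fract y ∈ Icc (0 : ℝ) 1 := ⟨Int.fract_nonneg y, (Int.fract_lt_one y).le⟩
  have hperz : ∀ i k : ℤ, C (i + k * N) = C i := by
    have h : Function.Periodic C N := hper
    exact fun i k => h.int_mul k i
  rcases proj_point_eq hx hy hxy with ⟨ht, hp⟩ | ⟨b, hb, hb'⟩
  · -- The two crossings meet in a triangle, so that they agree.
    have hd : (N : ℤ) ∣ ⌊x⌋ - ⌊y⌋ := by
      by_contra hd
      refine Set.disjoint_left.1 (hdisj _ _ hd ht) ((C ⌊x⌋).point_mem_seg hx) ?_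
      rw [hp]
      exact (C ⌊y⌋).point_mem_seg hy
    obtain ⟨k, hk⟩ := hd
    have hC : C ⌊x⌋ = C ⌊y⌋ := by
      rw [← hperz ⌊y⌋ k]
      congr 1
      linarith
    rw [hC] at hp
    have hf : Int.fract x = Int.fract y := (C ⌊y⌋).point_injOn hx hy hp
    refine ⟨k, ?_⟩
    have hk' : ((⌊x⌋ : ℝ) - ⌊y⌋) = N * k := by exact_mod_cast hk
    rw [Int.fract, Int.fract] at hf
    linarith
  · -- The starts of two crossings of a closed chain are never glued to each other.
    exfalso
    have h0 : b = (C ⌊x⌋).start := hb.elim And.right fun h =>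
      absurd h.1 (Int.fract_lt_one x).ne
    have h1 : flip b = (C ⌊y⌋).start := hb'.elim And.right fun h =>
      absurd h.1 (Int.fract_lt_one y).ne
    have h2 : (C ⌊x⌋).start = (C (⌊y⌋ - 1)).finish := by
      have h3 := hglue (⌊y⌋ - 1)
      rw [sub_add_cancel, ← h1] at h3
      rw [← h0, ← flip_flip b, ← h3, flip_flip]
    have hd : (N : ℤ) ∣ ⌊x⌋ - (⌊y⌋ - 1) := by
      by_contra hd
      have ht : (C ⌊x⌋).t = (C (⌊y⌋ - 1)).t := congrArg (fun x => x.1.1) h2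
      have hi : (C ⌊x⌋).i = (C (⌊y⌋ - 1)).j := congrArg (fun x => x.1.2) h2
      have hu : (C ⌊x⌋).u = (C (⌊y⌋ - 1)).v := congrArg (fun x => x.2) h2
      refine Set.disjoint_left.1 (hdisj _ _ hd ht) (left_mem_segment ..) ?_
      rw [hi, hu]
      exact right_mem_segment ..
    obtain ⟨k, hk⟩ := hd
    have hC : C ⌊x⌋ = C (⌊y⌋ - 1) := by
      rw [← hperz (⌊y⌋ - 1) k]
      congr 1
      linarith
    rw [hC] at h2
    exact start_ne_finish _ h2

/-- A finite cycle of a permutation, whose elements are crossings each of which starts where the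
preceding one stops, is a simple closed curve if its crossings are pairwise disjoint. -/
theorem isSimpleClosedCurve_cycle {ι : Type*} (f : Equiv.Perm ι) (C : ι → D.Crossing) {c : ι}
    (hc : c ∈ Function.periodicPts f) (hglue : ∀ i, flip (C i).finish = (C (f i)).start)
    (hdisj : ∀ i j : ℤ, (f ^ i) c ≠ (f ^ j) c → (C ((f ^ i) c)).t = (C ((f ^ j) c)).t →
      Disjoint (C ((f ^ i) c)).seg (C ((f ^ j) c)).seg) :
    IsSimpleClosedCurve (⋃ i : ℤ, (C ((f ^ i) c)).image) := by
  have hdvd : ∀ k : ℤ, (f ^ k) c = c ↔ (Function.minimalPeriod f c : ℤ) ∣ k := fun k =>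
    MulAction.zpow_smul_eq_iff_minimalPeriod_dvd (a := f) (b := c)
  refine isSimpleClosedCurve_chain (C := fun i => C ((f ^ i) c))
    (Function.minimalPeriod_pos_of_mem_periodicPts hc).ne' (fun i => ?_) (fun i => ?_)
    fun i j hij => hdisj i j fun h => hij ?_
  · simp only [zpow_add, Equiv.Perm.mul_apply, (hdvd _).2 dvd_rfl]
  · rw [hglue, add_comm, zpow_one_add, Equiv.Perm.mul_apply]
  · rw [← hdvd, sub_eq_neg_add, zpow_add, Equiv.Perm.mul_apply, h, ← Equiv.Perm.mul_apply,
      ← zpow_add, neg_add_cancel, zpow_zero, Equiv.Perm.one_apply]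

end Crossing

end IdealTriangulation

/-! ### Chords in barycentric coordinates -/

namespace Fin

theorem add_two_add_one (k : Fin 3) : k + 2 + 1 = k := by revert k; decide

theorem add_one_add_two (k : Fin 3) : k + 1 + 2 = k := by revert k; decide

theorem add_one_add_one (k : Fin 3) : k + 1 + 1 = k + 2 := by revert k; decide

theorem add_two_add_two (k : Fin 3) : k + 2 + 2 = k + 1 := by revert k; decide

end Fin

theorem sum_eq_of_corner (k : Fin 3) (x : Fin 3 → ℝ) :
    ∑ j, x j = x k + x (k + 1) + x (k + 2) := by
  rw [Fin.sum_univ_three]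
  fin_cases k
  · rfl
  · change _ = x 1 + x 2 + x 0
    ring
  · change _ = x 2 + x 0 + x 1
    ring

/-- A chord is a part of the line that is given by its intercepts on the two sides at the corner. -/
theorem mem_chord_iff {k : Fin 3} {a : ℝ × ℝ} (h1 : 0 < a.1) (h2 : 0 < a.2) {x : Fin 3 → ℝ} :
    x ∈ chord k a ↔ 0 ≤ x (k + 1) ∧ 0 ≤ x (k + 2) ∧ ∑ j, x j = 1 ∧
      x (k + 1) * a.2 + x (k + 2) * a.1 = a.1 * a.2 := by
  have p0 := Fin.add_two_add_one k ▸ sidePoint_add_one (k + 2) a.1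
  have p1 := Fin.add_two_add_two k ▸ sidePoint_add_two (k + 2) a.1
  have p2 := sidePoint_self (k + 2) a.1
  have q0 := Fin.add_one_add_two k ▸ sidePoint_add_two (k + 1) (1 - a.2)
  have q1 := sidePoint_self (k + 1) (1 - a.2)
  have q2 := Fin.add_one_add_one k ▸ sidePoint_add_one (k + 1) (1 - a.2)
  constructor
  · rintro ⟨l, m, hl, hm, hlm, rfl⟩
    rw [sum_eq_of_corner k]
    simp only [Pi.add_apply, Pi.smul_apply, smul_eq_mul, p0, p1, p2, q0, q1, q2]
    refine ⟨by positivity, ?_, by linear_combination hlm, by linear_combination a.1 * a.2 * hlm⟩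
    rw [sub_sub_cancel, mul_zero, zero_add]
    positivity
  · rintro ⟨hx1, hx2, hs, hx⟩
    rw [sum_eq_of_corner k] at hs
    refine ⟨x (k + 1) / a.1, x (k + 2) / a.2, by positivity, by positivity, ?_, ?_⟩
    · field_simp
      linarith
    · ext j
      have hj : j = k ∨ j = k + 1 ∨ j = k + 2 := by
        generalize k = i
        revert i j
        decide
      simp only [Pi.add_apply, Pi.smul_apply, smul_eq_mul]
      rcases hj with rfl | rfl | rfl
      · rw [p0, q0]
        field_simp
        linear_combination hx - a.1 * a.2 * hs
      · rw [p1, q1]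
        field_simp
        ring
      · rw [p2, q2]
        field_simp
        ring

theorem disjoint_chord_of_lt {k k' : Fin 3} (hk : k ≠ k') {u : ℝ} (hu : u ∈ Ioo (0 : ℝ) (1 / 2)) :
    Disjoint (chord k (u, u)) (chord k' (u, u)) := by
  -- The barycentric coordinate at the vertex `k` is equal to `1 - u > 1 / 2` on the chord.
  have key : ∀ (k : Fin 3) (x : Fin 3 → ℝ), x ∈ chord k (u, u) →
      x k = 1 - u ∧ ∀ k', k ≠ k' → x k' ≤ u := by
    intro k x hx
    obtain ⟨h1, h2, hs, h⟩ := (mem_chord_iff hu.1 hu.1).1 hx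
    rw [sum_eq_of_corner k] at hs
    have h' : x (k + 1) + x (k + 2) = u :=
      mul_right_cancel₀ hu.1.ne' (by linear_combination h)
    refine ⟨by linarith, fun k' hk => ?_⟩
    have hj : k' = k + 1 ∨ k' = k + 2 := by
      clear * - hk
      revert k k'
      decide
    rcases hj with rfl | rfl <;> linarith
  rw [Set.disjoint_left]
  intro x hx hx'
  linarith [(key k x hx).1, (key k' x hx').2 k hk.symm, hu.2]

namespace IdealTriangulation

variable {F : Type*} [TopologicalSpace F] {D : IdealTriangulation F}

/-- The chord that cuts off a corner, directed so as to turn around the vertex in the direction of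
`IdealTriangulation.turn`. -/
@[simps]
def Crossing.ofChord (c : D.Corner) (a : ℝ × ℝ) (ha : a ∈ Ioo (0 : ℝ) 1 ×ˢ Ioo (0 : ℝ) 1) :
    D.Crossing where
  t := c.1
  i := c.2 + 2
  j := c.2 + 1
  u := a.1
  v := 1 - a.2
  ne := by
    generalize c.2 = k
    revert k
    decide
  hu := ha.1
  hv := ⟨sub_pos.2 ha.2.2, sub_lt_self _ ha.2.1⟩

/-! ### Collar curves -/

/-- The rotation of the corners around the punctures. -/
noncomputable def turnPerm (D : IdealTriangulation F) : Equiv.Perm D.Corner :=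
  Equiv.ofBijective D.turn (Finite.injective_iff_bijective.1 fun c c' h => by
    have h1 := congrArg Prod.fst h
    have h2 := add_right_cancel (congrArg Prod.snd h)
    have h3 : D.glue (c.1, c.2 + 1) = D.glue (c'.1, c'.2 + 1) := Prod.ext h1 h2
    have h4 := congrArg D.glue h3
    rw [D.glue_glue, D.glue_glue, Prod.ext_iff] at h4
    exact Prod.ext h4.1 (add_right_cancel h4.2))

theorem puncture_eq_iff {c c' : D.Corner} :
    D.puncture c = D.puncture c' ↔ D.turnPerm.SameCycle c c' := by
  constructor
  · intro h
    have h' := Quot.eqvGen_exact h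
    clear h
    induction h' with
    | rel x y h =>
      subst h
      exact ⟨1, rfl⟩
    | refl x => exact Equiv.Perm.SameCycle.refl _ _
    | symm x y _ ih => exact ih.symm
    | trans x y z _ _ ih1 ih2 => exact ih1.trans ih2
  · rintro ⟨i, rfl⟩
    have h : ∀ c, D.puncture c = D.puncture (D.turnPerm c) := fun c => Quot.sound rfl
    induction i with
    | zero => rfl
    | succ i ih => rw [ih, h, add_comm, zpow_one_add, Equiv.Perm.mul_apply]
    | pred i ih =>
      rw [ih, h ((D.turnPerm ^ (-(i : ℤ) - 1)) c), ← Equiv.Perm.mul_apply, ← zpow_one_add,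
        add_sub_cancel]

/-- Collar curves close to a puncture are simple closed curves. -/
theorem isSimpleClosedCurve_collar (p : D.Puncture) {u : ℝ} (hu : u ∈ Ioo (0 : ℝ) (1 / 2)) :
    IsSimpleClosedCurve (D.collar p u) := by
  obtain ⟨c, rfl⟩ := Quot.exists_rep p
  have hu1 : u ∈ Ioo (0 : ℝ) 1 := ⟨hu.1, by linarith [hu.2]⟩
  have h := Crossing.isSimpleClosedCurve_cycle D.turnPerm
    (fun c => Crossing.ofChord c (u, u) ⟨hu1, hu1⟩) (c := c)
    (D.turnPerm.injective.mem_periodicPts c) (fun c => ?_) fun i j hij ht => ?_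
  · convert h using 1
    refine (iUnion_subset fun c' => iUnion_subset fun hc' => ?_).antisymm
      (iUnion_subset fun i => ?_)
    · obtain ⟨i, rfl⟩ := puncture_eq_iff.1 hc'.symm
      exact subset_iUnion (fun i : ℤ =>
        (Crossing.ofChord ((D.turnPerm ^ i) c) (u, u) ⟨hu1, hu1⟩).image) i
    · exact subset_iUnion₂_of_subset _ (puncture_eq_iff.2 ⟨i, rfl⟩).symm subset_rfl
  · simp [flip, Crossing.finish, Crossing.start, Crossing.ofChord, turnPerm, turn,
      Fin.add_one_add_two]
  · exact disjoint_chord_of_lt (fun h => hij (Prod.ext ht h)) hu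

/-! ### Leaves as orbits of directed chords -/

namespace MeasuredLamination

variable (L : D.MeasuredLamination)

/-- A chord of a measured lamination, directed as in `Crossing.ofChord` or in the opposite
direction. -/
structure DirectedChord where
  corner : D.Corner
  ends : ℝ × ℝ
  mem : ends ∈ L.chords corner
  forward : Bool

namespace DirectedChord

variable {L}

/-- A directed chord, as a crossing. -/
def crossing (C : L.DirectedChord) : D.Crossing :=
  bif C.forward then .ofChord C.corner C.ends (L.chords_subset _ C.mem)
  else (Crossing.ofChord C.corner C.ends (L.chords_subset _ C.mem)).reverse

theorem seg_crossing (C : L.DirectedChord) : C.crossing.seg = chord C.corner.2 C.ends := by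
  obtain ⟨c, a, h, _ | _⟩ := C
  exacts [Crossing.seg_reverse _, rfl]

theorem image_crossing (C : L.DirectedChord) : C.crossing.image = D.arc C.corner C.ends := by
  obtain ⟨c, a, h, _ | _⟩ := C
  exacts [Crossing.image_reverse _, rfl]

theorem t_crossing (C : L.DirectedChord) : C.crossing.t = C.corner.1 := by
  obtain ⟨c, a, h, _ | _⟩ := C <;> rfl

/-- A directed chord, run through in the opposite direction. -/
def reverse (C : L.DirectedChord) : L.DirectedChord := ⟨C.corner, C.ends, C.mem, !C.forward⟩

theorem reverse_involutive : Function.Involutive (reverse (L := L)) := fun C => by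
  simp [reverse]

theorem crossing_reverse (C : L.DirectedChord) : C.reverse.crossing = C.crossing.reverse := by
  obtain ⟨c, a, h, _ | _⟩ := C <;> rfl

theorem reverse_ne (C : L.DirectedChord) : C.reverse ≠ C := fun h => by
  have := congrArg DirectedChord.forward h
  simp [reverse] at this

theorem eq_or_eq_reverse {C C' : L.DirectedChord} (ht : C.crossing.t = C'.crossing.t)
    (h : ¬ Disjoint C.crossing.seg C'.crossing.seg) : C' = C ∨ C' = C.reverse := by
  rw [seg_crossing, seg_crossing] at h
  rw [t_crossing, t_crossing] at ht
  obtain ⟨⟨t, k⟩, a, ha, f⟩ := C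
  obtain ⟨⟨t', k'⟩, a', ha', f'⟩ := C'
  obtain rfl : t = t' := ht
  have heq : (k, a) = (k', a') := by
    by_contra hne
    exact h (L.disjoint_chords t k k' a a' ha ha' hne)
  obtain ⟨rfl, rfl⟩ := Prod.mk_inj.1 heq
  cases f <;> cases f' <;> simp [reverse]

/-- Through a point of an arc of the triangulation there is at most one chord on either side. -/
theorem start_injective : Function.Injective fun C : L.DirectedChord => C.crossing.start := by
  intro C C' h
  have ht : C.crossing.t = C'.crossing.t := congrArg (fun x => x.1.1) h
  have hi : C.crossing.i = C'.crossing.i := congrArg (fun x => x.1.2) h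
  have hu : C.crossing.u = C'.crossing.u := congrArg (fun x => x.2) h
  rcases eq_or_eq_reverse ht (Set.not_disjoint_iff.2 ⟨_, left_mem_segment .., by
    rw [hi, hu]; exact left_mem_segment ..⟩) with rfl | rfl
  · rfl
  · rw [crossing_reverse] at hi
    exact absurd hi C.crossing.ne

theorem exists_start {x : D.Side × ℝ} (hx : x.2 ∈ L.trace x.1) :
    ∃ C : L.DirectedChord, C.crossing.start = x := by
  obtain ⟨⟨t, i⟩, u⟩ := x
  rw [L.trace_eq] at hx
  rcases hx with ⟨a, ha, rfl⟩ | ⟨a, ha, rfl⟩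
  · exact ⟨⟨_, a, ha, true⟩, by simp [crossing, Crossing.start, Fin.add_one_add_two]⟩
  · exact ⟨⟨_, a, ha, false⟩, by simp [crossing, Crossing.start, Fin.add_two_add_one]⟩

theorem start_mem_trace (C : L.DirectedChord) : C.crossing.u ∈ L.trace C.crossing.start.1 := by
  obtain ⟨⟨t, k⟩, a, ha, _ | _⟩ := C
  · rw [L.trace_eq]
    refine Or.inr ⟨a, ?_, rfl⟩
    simpa [crossing, Crossing.start, Fin.add_one_add_two] using ha
  · rw [L.trace_eq]
    refine Or.inl ⟨a, ?_, rfl⟩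
    simpa [crossing, Crossing.start, Fin.add_two_add_one] using ha

theorem exists_across (C : L.DirectedChord) :
    ∃ C' : L.DirectedChord, C'.crossing.start = flip C.crossing.start := by
  refine exists_start ?_
  simp only [flip, L.trace_glue]
  exact mem_image_of_mem _ C.start_mem_trace

/-- The directed chord on the other side of the arc of the triangulation on which a directed chord
starts, with the same starting point. -/
noncomputable def across (C : L.DirectedChord) : L.DirectedChord := C.exists_across.choose

theorem start_across (C : L.DirectedChord) :
    C.across.crossing.start = flip C.crossing.start := C.exists_across.choose_spec

theorem across_involutive : Function.Involutive (across (L := L)) := fun C =>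
  start_injective (by simp only [start_across, flip_flip])

theorem across_ne (C : L.DirectedChord) : C.across ≠ C := fun h =>
  flip_ne C.crossing.start (by rw [← start_across, h])

variable (L) in
/-- The continuation of a directed chord along its leaf. -/
noncomputable def next : Equiv.Perm L.DirectedChord :=
  across_involutive.toPerm * reverse_involutive.toPerm

theorem next_apply (C : L.DirectedChord) : next L C = C.reverse.across := rfl

theorem next_inv_apply (C : L.DirectedChord) : (next L)⁻¹ C = C.across.reverse := rfl

theorem flip_finish (C : L.DirectedChord) :
    flip C.crossing.finish = (next L C).crossing.start := by
  rw [next_apply, start_across, crossing_reverse]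
  rfl

theorem reverse_next_zpow (C : L.DirectedChord) (i : ℤ) :
    ((next L ^ i) C).reverse = (next L ^ (-i)) C.reverse := by
  have h : reverse_involutive.toPerm * next L * reverse_involutive.toPerm⁻¹ = (next L)⁻¹ := by
    ext1 B
    exact congrArg (fun C => reverse (across C)) (reverse_involutive B)
  have h' := conj_zpow (a := reverse_involutive.toPerm) (b := next L) (i := i)
  rw [h, inv_zpow, ← zpow_neg, eq_mul_inv_iff_mul_eq] at h'
  exact (Equiv.congr_fun h' C).symm

/-- A leaf never runs through a chord in both directions: otherwise one of the involutions `reverse`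
and `across` would have a fixed point halfway. -/
theorem reverse_next_zpow_ne (C : L.DirectedChord) (i j : ℤ) :
    ((next L ^ i) C).reverse ≠ (next L ^ j) C := by
  intro h
  have h : C.reverse = (next L ^ (i + j)) C := by
    rw [reverse_next_zpow] at h
    rw [zpow_add, Equiv.Perm.mul_apply, ← h, ← Equiv.Perm.mul_apply, ← zpow_add,
      add_neg_cancel, zpow_zero, Equiv.Perm.one_apply]
  rcases Int.even_or_odd' (i + j) with ⟨m, hm | hm⟩
  · apply reverse_ne ((next L ^ m) C)
    rw [reverse_next_zpow, h, hm, ← Equiv.Perm.mul_apply, ← zpow_add]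
    congr 2
    ring
  · apply across_ne ((next L ^ (m + 1)) C)
    have h1 : (next L ^ (m + 1)) C = ((next L ^ m) C).reverse.across := by
      rw [add_comm, zpow_one_add, Equiv.Perm.mul_apply, next_apply]
    have h2 : ((next L ^ m) C).reverse = (next L ^ (m + 1)) C := by
      rw [reverse_next_zpow, h, hm, ← Equiv.Perm.mul_apply, ← zpow_add]
      congr 2
      ring
    rw [h2] at h1
    exact h1.symm

/-- Directed chords with images that meet in the surface are related by reversals and by crossing
arcs of the triangulation. -/
theorem of_mem_image {P : L.DirectedChord → Prop} (hrev : ∀ C, P C → P C.reverse)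
    (hacr : ∀ C, P C → P C.across) {C C' : L.DirectedChord} {z : F} (hz : z ∈ C.crossing.image)
    (hz' : z ∈ C'.crossing.image) (hC : P C) : P C' := by
  rw [Crossing.image_eq] at hz hz'
  obtain ⟨r, hr, rfl⟩ := hz
  obtain ⟨r', hr', h⟩ := hz'
  rcases Crossing.proj_point_eq hr hr' h.symm with ⟨ht, hp⟩ | ⟨x, hx, hx'⟩
  · rcases eq_or_eq_reverse ht (Set.not_disjoint_iff.2 ⟨_, C.crossing.point_mem_seg hr, by
      rw [hp]; exact C'.crossing.point_mem_seg hr'⟩) with rfl | rfl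
    exacts [hC, hrev _ hC]
  · obtain ⟨C₁, hC₁, rfl⟩ : ∃ C₁, P C₁ ∧ C₁.crossing.start = x := by
      rcases hx with ⟨-, rfl⟩ | ⟨-, rfl⟩
      exacts [⟨C, hC, rfl⟩, ⟨C.reverse, hrev _ hC, by rw [crossing_reverse]; rfl⟩]
    rw [← start_across] at hx'
    rcases hx' with ⟨-, hx'⟩ | ⟨-, hx'⟩
    · rw [← start_injective hx']
      exact hacr _ hC₁
    · have h : C₁.across = C'.reverse := start_injective (by
        simp only [crossing_reverse, hx']; rfl)
      rw [← reverse_involutive C', ← h]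
      exact hrev _ (hacr _ hC₁)

theorem onArc_iff {x y : F} :
    L.OnArc x y ↔ ∃ C : L.DirectedChord, x ∈ C.crossing.image ∧ y ∈ C.crossing.image := by
  constructor
  · rintro ⟨c, a, ha, hx, hy⟩
    exact ⟨⟨c, a, ha, true⟩, hx, hy⟩
  · rintro ⟨C, hx, hy⟩
    rw [image_crossing] at hx hy
    exact ⟨_, _, C.mem, hx, hy⟩

theorem reflTransGen_onArc {C : L.DirectedChord} {x y : F} (hx : x ∈ C.crossing.image) :
    Relation.ReflTransGen L.OnArc x y ↔ ∃ i : ℤ, y ∈ ((next L ^ i) C).crossing.image := by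
  constructor
  · intro h
    induction h with
    | refl => exact ⟨0, hx⟩
    | @tail y z _ hyz ih =>
      obtain ⟨C', hy, hz⟩ := onArc_iff.1 hyz
      obtain ⟨i, hi⟩ := ih
      have hj : ∃ i : ℤ, C' = (next L ^ i) C ∨ C'.reverse = (next L ^ i) C := by
        refine of_mem_image (P := fun B => ∃ i : ℤ, B = (next L ^ i) C ∨ B.reverse = (next L ^ i) C)
          (fun B => ?_) (fun B => ?_) hi hy ⟨i, Or.inl rfl⟩
        · rintro ⟨i, h | h⟩
          · exact ⟨i, Or.inr (by rwa [reverse_involutive])⟩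
          · exact ⟨i, Or.inl h⟩
        · rintro ⟨i, h | h⟩
          · refine ⟨-1 + i, Or.inr ?_⟩
            rw [zpow_add, Equiv.Perm.mul_apply, zpow_neg_one, ← h, next_inv_apply]
          · refine ⟨1 + i, Or.inl ?_⟩
            rw [zpow_add, Equiv.Perm.mul_apply, zpow_one, ← h, next_apply, reverse_involutive]
      obtain ⟨j, rfl | h⟩ := hj
      · exact ⟨j, hz⟩
      · exact ⟨j, by rwa [← h, crossing_reverse, Crossing.image_reverse]⟩
  · -- Consecutive chords have a common end.
    have hmeet : ∀ B : L.DirectedChord, ∃ z, z ∈ B.crossing.image ∧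
        z ∈ (next L B).crossing.image := by
      intro B
      simp only [Crossing.image_eq]
      exact ⟨_, ⟨1, by simp, rfl⟩, 0, by simp, (Crossing.proj_eq_of_flip_eq B.flip_finish).symm⟩
    rintro ⟨i, hi⟩
    induction i generalizing y with
    | zero => exact .single (onArc_iff.2 ⟨C, hx, hi⟩)
    | succ i ih =>
      obtain ⟨z, hz, hz'⟩ := hmeet ((next L ^ (i : ℤ)) C)
      rw [add_comm, zpow_one_add, Equiv.Perm.mul_apply] at hi
      exact (ih hz).tail (onArc_iff.2 ⟨_, hz', hi⟩)
    | pred i ih =>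
      obtain ⟨z, hz, hz'⟩ := hmeet ((next L ^ (-(i : ℤ) - 1)) C)
      rw [← Equiv.Perm.mul_apply, ← zpow_one_add, add_sub_cancel] at hz'
      exact (ih hz').tail (onArc_iff.2 ⟨_, hz, hi⟩)

theorem isSimpleClosedCurve_of_mem_periodicPts {C : L.DirectedChord}
    (hC : C ∈ Function.periodicPts (next L)) {x : F} (hx : x ∈ C.crossing.image) :
    IsSimpleClosedCurve {y | Relation.ReflTransGen L.OnArc x y} := by
  have h := Crossing.isSimpleClosedCurve_cycle (next L) crossing hC flip_finish
    fun i j hij ht => ?_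
  · convert h using 1
    ext y
    rw [mem_ofPred_eq, reflTransGen_onArc hx, mem_iUnion]
  · by_contra hd
    rcases eq_or_eq_reverse ht hd with h | h
    · exact hij h.symm
    · exact reverse_next_zpow_ne C i j h.symm

end DirectedChord

/-- Every leaf is a simple closed curve if some function on the points of the lamination on the
arcs of the triangulation is constant along the leaves and has finite fibres. -/
theorem isSimpleClosedCurve_of_isLeaf {L : D.MeasuredLamination} {H : D.Side × ℝ → ℝ}
    (hflip : ∀ x, H (flip x) = H x)
    (hchord : ∀ C : L.DirectedChord, H C.crossing.finish = H C.crossing.start)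
    (hfin : ∀ s r, {u ∈ L.trace s | H (s, u) = r}.Finite) {S : Set F} (hS : L.IsLeaf S) :
    IsSimpleClosedCurve S := by
  obtain ⟨x, hx, rfl⟩ := hS
  simp only [carrier, mem_iUnion] at hx
  obtain ⟨c, a, ha, hx⟩ := hx
  let C : L.DirectedChord := ⟨c, a, ha, true⟩
  refine DirectedChord.isSimpleClosedCurve_of_mem_periodicPts (C := C) ?_ hx
  have hH : ∀ n : ℕ, H ((DirectedChord.next L)^[n] C).crossing.start = H C.crossing.start := by
    intro n
    induction n with
    | zero => rfl
    | succ n ih => rw [Function.iterate_succ_apply', ← DirectedChord.flip_finish, hflip, hchord, ih]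
  have hlevel : {B : L.DirectedChord | H B.crossing.start = H C.crossing.start}.Finite := by
    refine Finite.of_finite_image (f := fun B => B.crossing.start) ?_
      DirectedChord.start_injective.injOn
    refine (finite_iUnion fun s => (hfin s (H C.crossing.start)).image (Prod.mk s)).subset ?_
    rintro _ ⟨B, hB, rfl⟩
    exact mem_iUnion.2 ⟨B.crossing.start.1, B.crossing.u, ⟨B.start_mem_trace, hB⟩, rfl⟩
  obtain ⟨m, -, n, -, hmn, h⟩ := infinite_univ.exists_lt_map_eq_of_mapsTo
    (f := fun n : ℕ => (DirectedChord.next L)^[n] C) (fun n _ => hH n) hlevel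
  refine ⟨n - m, Nat.sub_pos_of_lt hmn, ?_⟩
  apply (DirectedChord.next L).injective.iterate m
  rw [← Function.iterate_add_apply, Nat.add_sub_cancel' hmn.le]
  exact h.symm

end MeasuredLamination

end IdealTriangulation

/-! ### The order of disjoint chords -/

theorem chord_nonneg {k : Fin 3} {a : ℝ × ℝ} (ha : a ∈ Ioo (0 : ℝ) 1 ×ˢ Ioo (0 : ℝ) 1)
    {x : Fin 3 → ℝ} (hx : x ∈ chord k a) (j : Fin 3) : 0 ≤ x j := by
  obtain ⟨l, m, hl, hm, -, rfl⟩ := hx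
  have h1 := sidePoint_nonneg (k + 2) j ha.1
  have h2 := sidePoint_nonneg (k + 1) j (u := 1 - a.2)
    ⟨sub_pos.2 ha.2.2, sub_lt_self _ ha.2.1⟩
  simp only [Pi.add_apply, Pi.smul_apply, smul_eq_mul]
  positivity

theorem exists_mem_chord_eq {k : Fin 3} {a : ℝ × ℝ} {f : (Fin 3 → ℝ) → ℝ} (hf : Continuous f)
    {r : ℝ} (h1 : f (sidePoint (k + 2) a.1) ≤ r) (h2 : r ≤ f (sidePoint (k + 1) (1 - a.2))) :
    ∃ x ∈ chord k a, f x = r :=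
  (convex_segment _ _).isPreconnected.intermediate_value (left_mem_segment ..)
    (right_mem_segment ..) hf.continuousOn ⟨h1, h2⟩

/-- Two chords at the same corner meet unless they are nested. -/
theorem not_disjoint_chord_of_le {k : Fin 3} {a b : ℝ × ℝ}
    (ha : a ∈ Ioo (0 : ℝ) 1 ×ˢ Ioo (0 : ℝ) 1) (hb : b ∈ Ioo (0 : ℝ) 1 ×ˢ Ioo (0 : ℝ) 1)
    (h1 : a.1 ≤ b.1) (h2 : b.2 ≤ a.2) : ¬ Disjoint (chord k a) (chord k b) := by
  obtain ⟨x, hx, hxb⟩ := exists_mem_chord_eq (k := k) (a := a) (r := b.1 * b.2)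
    (f := fun x => x (k + 1) * b.2 + x (k + 2) * b.1) (by fun_prop) (by
      have e1 := Fin.add_two_add_two k ▸ sidePoint_add_two (k + 2) a.1
      rw [e1, sidePoint_self]
      nlinarith [hb.2.1]) (by
      have e1 := Fin.add_one_add_one k ▸ sidePoint_add_one (k + 1) (1 - a.2)
      rw [e1, sidePoint_self]
      nlinarith [hb.1.1])
  obtain ⟨p1, p2, p3, -⟩ := (mem_chord_iff ha.1.1 ha.2.1).1 hx
  exact Set.not_disjoint_iff.2 ⟨x, hx, (mem_chord_iff hb.1.1 hb.2.1).2 ⟨p1, p2, p3, hxb⟩⟩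

/-- Two chords at distinct corners meet if their ends on the common side overlap. -/
theorem not_disjoint_chord_add_one {k : Fin 3} {a b : ℝ × ℝ}
    (ha : a ∈ Ioo (0 : ℝ) 1 ×ˢ Ioo (0 : ℝ) 1) (hb : b ∈ Ioo (0 : ℝ) 1 ×ˢ Ioo (0 : ℝ) 1)
    (h : 1 - b.2 ≤ a.1) : ¬ Disjoint (chord k a) (chord (k + 1) b) := by
  obtain ⟨x, hx, hxb⟩ := exists_mem_chord_eq (k := k) (a := a) (r := b.1 * b.2)
    (f := fun x => x (k + 2) * b.2 + x k * b.1) (by fun_prop) (by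
      have e1 := Fin.add_two_add_one k ▸ sidePoint_add_one (k + 2) a.1
      rw [e1, sidePoint_self]
      nlinarith [hb.1.1]) (by
      have e1 := Fin.add_one_add_one k ▸ sidePoint_add_one (k + 1) (1 - a.2)
      have e2 := Fin.add_one_add_two k ▸ sidePoint_add_two (k + 1) (1 - a.2)
      rw [e1, e2]
      have p1 := mul_nonneg (mul_pos ha.2.1 hb.2.1).le (sub_pos.2 hb.1.2).le
      have p2 := mul_nonneg (mul_pos (sub_pos.2 ha.2.2) hb.1.1).le (sub_pos.2 hb.2.2).le
      linarith)
  refine Set.not_disjoint_iff.2 ⟨x, hx, (mem_chord_iff hb.1.1 hb.2.1).2 ⟨?_, ?_, ?_, ?_⟩⟩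
  · exact chord_nonneg ha hx _
  · exact chord_nonneg ha hx _
  · exact ((mem_chord_iff ha.1.1 ha.2.1).1 hx).2.2.1
  · rwa [Fin.add_one_add_one, Fin.add_one_add_two]

namespace IdealTriangulation

variable {F : Type*} [TopologicalSpace F] {D : IdealTriangulation F}

namespace MeasuredLamination

variable (L : D.MeasuredLamination)

variable {L} in
theorem fst_le_iff {c : D.Corner} {a b : ℝ × ℝ} (ha : a ∈ L.chords c) (hb : b ∈ L.chords c) :
    a.1 ≤ b.1 ↔ a.2 ≤ b.2 := by
  constructor
  · intro h
    by_contra! h2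
    refine not_disjoint_chord_of_le (L.chords_subset _ ha) (L.chords_subset _ hb) h h2.le
      (L.disjoint_chords c.1 c.2 c.2 a b ha hb fun e => ?_)
    rw [(Prod.mk_inj.1 e).2] at h2
    exact lt_irrefl _ h2
  · intro h
    by_contra! h2
    refine not_disjoint_chord_of_le (L.chords_subset _ hb) (L.chords_subset _ ha) h2.le h
      (L.disjoint_chords c.1 c.2 c.2 b a hb ha fun e => ?_)
    rw [(Prod.mk_inj.1 e).2] at h2
    exact lt_irrefl _ h2

variable {L} in
theorem fst_lt_one_sub_snd {t : Fin D.n} {k : Fin 3} {a b : ℝ × ℝ} (ha : a ∈ L.chords (t, k))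
    (hb : b ∈ L.chords (t, k + 1)) : a.1 < 1 - b.2 := by
  by_contra! h
  refine not_disjoint_chord_add_one (L.chords_subset _ ha) (L.chords_subset _ hb) h
    (L.disjoint_chords t k (k + 1) a b ha hb fun e => ?_)
  have := (Prod.mk_inj.1 e).1
  revert this
  generalize k = i
  revert i
  decide

/-! ### The transverse measure -/

instance (s : D.Side) : IsFiniteMeasure (L.mass s) := L.finite_mass s

theorem mass_inter_trace (s : D.Side) (A : Set ℝ) : L.mass s (A ∩ L.trace s) = L.mass s A := by
  rw [← L.support_mass]
  exact measure_inter_conull (L.mass s).measure_compl_support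

theorem trace_add_two (t : Fin D.n) (k : Fin 3) : L.trace (t, k + 2) =
    (fun a => a.1) '' L.chords (t, k) ∪ (fun a => 1 - a.2) '' L.chords (t, k + 1) := by
  rw [L.trace_eq, Fin.add_two_add_one, Fin.add_two_add_two]

theorem trace_add_one (t : Fin D.n) (k : Fin 3) : L.trace (t, k + 1) =
    (fun a => a.1) '' L.chords (t, k + 2) ∪ (fun a => 1 - a.2) '' L.chords (t, k) := by
  rw [L.trace_eq, Fin.add_one_add_one, Fin.add_one_add_two]

/-- The transverse measure of the leaves that cut off a corner. -/
noncomputable def cornerMass (c : D.Corner) : ℝ :=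
  (L.mass (c.1, c.2 + 2)).real ((fun a => a.1) '' L.chords c)

theorem mass_univ (t : Fin D.n) (i : Fin 3) : (L.mass (t, i)).real univ =
    L.cornerMass (t, i + 1) + L.cornerMass (t, i + 2) := by
  have h1 : L.cornerMass (t, i + 2) =
      (L.mass (t, i)).real ((fun a => 1 - a.2) '' L.chords (t, i + 2)) := by
    have h := L.mass_chords t (i + 2) _ subset_rfl (L.isCompact_chords _).measurableSet
    rw [Fin.add_two_add_one] at h
    exact congrArg ENNReal.toReal h
  rw [measureReal_def, ← L.mass_inter_trace, univ_inter, L.trace_eq, ← measureReal_def,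
    measureReal_union, ← h1]
  · simp only [cornerMass, Fin.add_one_add_two]
  · rw [Set.disjoint_left]
    rintro _ ⟨a, ha, rfl⟩ ⟨b, hb, h⟩
    rw [← Fin.add_one_add_one] at hb
    exact (fst_lt_one_sub_snd ha hb).ne' h
  · exact ((L.isCompact_chords _).image (by fun_prop)).measurableSet

section

variable {L}
variable {t : Fin D.n} {k : Fin 3} {a : ℝ × ℝ}

theorem mass_Iio (ha : a ∈ L.chords (t, k)) : L.mass (t, k + 2) (Iio a.1) =
    L.mass (t, k + 2) ((fun a => a.1) '' (L.chords (t, k) ∩ {b | b.1 < a.1})) := by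
  rw [← L.mass_inter_trace, trace_add_two]
  congr 1
  ext u
  constructor
  · rintro ⟨hu, ⟨b, hb, rfl⟩ | ⟨b, hb, rfl⟩⟩
    · exact ⟨b, ⟨hb, hu⟩, rfl⟩
    · exact absurd hu (fst_lt_one_sub_snd ha hb).not_gt
  · rintro ⟨b, ⟨hb, hu⟩, rfl⟩
    exact ⟨hu, Or.inl ⟨b, hb, rfl⟩⟩

theorem mass_Ioi (ha : a ∈ L.chords (t, k)) : L.mass (t, k + 1) (Ioi (1 - a.2)) =
    L.mass (t, k + 1) ((fun a => 1 - a.2) '' (L.chords (t, k) ∩ {b | b.1 < a.1})) := by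
  rw [← L.mass_inter_trace, trace_add_one]
  congr 1
  ext u
  constructor
  · rintro ⟨hu, ⟨b, hb, rfl⟩ | ⟨b, hb, rfl⟩⟩
    · rw [← Fin.add_two_add_one k] at ha
      exact absurd hu (fst_lt_one_sub_snd hb ha).not_gt
    · refine ⟨b, ⟨hb, ?_⟩, rfl⟩
      rw [mem_Ioi, sub_lt_sub_iff_left] at hu
      exact lt_of_not_ge fun h => hu.not_ge ((fst_le_iff ha hb).1 h)
  · rintro ⟨b, ⟨hb, hu⟩, rfl⟩
    refine ⟨?_, Or.inr ⟨b, hb, rfl⟩⟩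
    rw [mem_Ioi, sub_lt_sub_iff_left]
    exact lt_of_not_ge fun h => (not_le_of_gt hu) ((fst_le_iff ha hb).2 h)

theorem mass_Iio_eq_mass_Ioi (ha : a ∈ L.chords (t, k)) :
    L.mass (t, k + 2) (Iio a.1) = L.mass (t, k + 1) (Ioi (1 - a.2)) := by
  rw [mass_Iio ha, mass_Ioi ha]
  exact L.mass_chords t k _ inter_subset_left
    ((L.isCompact_chords _).measurableSet.inter (measurableSet_lt (by fun_prop) (by fun_prop)))

theorem mass_singleton (ha : a ∈ L.chords (t, k)) :
    L.mass (t, k + 2) {a.1} = L.mass (t, k + 1) {1 - a.2} := by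
  have h := L.mass_chords t k {a} (singleton_subset_iff.2 ha) (measurableSet_singleton a)
  rwa [image_singleton, image_singleton] at h

theorem mass_Iio_add_mass_singleton_le (ha : a ∈ L.chords (t, k)) :
    (L.mass (t, k + 2)).real (Iio a.1) + (L.mass (t, k + 2)).real {a.1} ≤
      L.cornerMass (t, k) := by
  rw [measureReal_def, mass_Iio ha, ← measureReal_def, ← measureReal_union]
  · refine measureReal_mono (union_subset (image_mono inter_subset_left) ?_)
    exact singleton_subset_iff.2 (mem_image_of_mem _ ha)
  · rw [Set.disjoint_singleton_right]
    rintro ⟨b, hb, h⟩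
    exact (ne_of_lt hb.2) h
  · exact measurableSet_singleton _

end

end MeasuredLamination

/-! ### The height of a leaf -/

namespace DecoratedMeasuredLamination

variable (L : D.DecoratedMeasuredLamination)

/-- The weighted distance of a point of an arc of the triangulation from the puncture where the side
starts: the decoration of the puncture plus the transverse measure of the segment between the two.
Half of an atom at the point itself is counted. -/
noncomputable def depth (x : D.Side × ℝ) : ℝ :=
  L.decoration (D.source x.1) + (L.mass x.1).real (Iio x.2) + (L.mass x.1).real {x.2} / 2

/-- The smaller one of the weighted distances of a point of an arc of the triangulation from the
two ends of the arc. -/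
noncomputable def height (x : D.Side × ℝ) : ℝ := min (L.depth x) (L.depth (flip x))

/-- The sum of the decoration at a corner and of the transverse measure of the leaves that cut it
off. -/
noncomputable def cornerWeight (c : D.Corner) : ℝ :=
  L.cornerMass c + L.decoration (D.puncture c)

theorem height_flip (x : D.Side × ℝ) : L.height (flip x) = L.height x := by
  rw [height, height, flip_flip, min_comm]

theorem measure_edge (t : Fin D.n) (i : Fin 3) : L.measure (D.edge (t, i)) =
    L.cornerWeight (t, i + 1) + L.cornerWeight (t, i + 2) := by
  change (L.mass (t, i)).real univ + L.decoration (D.puncture (t, i + 1)) +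
    L.decoration (D.puncture (t, i + 2)) = _
  rw [L.mass_univ, cornerWeight, cornerWeight]
  ring

theorem depth_flip (x : D.Side × ℝ) : L.depth (flip x) = L.decoration (D.target x.1) +
    (L.mass x.1).real (Ioi x.2) + (L.mass x.1).real {x.2} / 2 := by
  have h1 : (fun u : ℝ => 1 - u) ⁻¹' Iio (1 - x.2) = Ioi x.2 := by
    ext u
    simp
  have h2 : (fun u : ℝ => 1 - u) ⁻¹' {1 - x.2} = {x.2} := by
    ext u
    simp
  simp only [depth, flip, D.source_glue, L.mass_glue]
  rw [map_measureReal_apply (by fun_prop) measurableSet_Iio,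
    map_measureReal_apply (by fun_prop) (measurableSet_singleton _), h1, h2]

theorem depth_add_depth_flip (x : D.Side × ℝ) :
    L.depth x + L.depth (flip x) = L.measure (D.edge x.1) := by
  have h : (L.mass x.1).real univ =
      (L.mass x.1).real (Iio x.2) + (L.mass x.1).real {x.2} + (L.mass x.1).real (Ioi x.2) := by
    rw [← measureReal_union (by simp) (measurableSet_singleton _), Iio_union_right,
      ← measureReal_union (Iic_disjoint_Ioi le_rfl) measurableSet_Ioi, Iic_union_Ioi]
  change _ = (L.mass x.1).real univ + L.decoration (D.source x.1) + L.decoration (D.target x.1)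
  rw [depth_flip, depth, h]
  ring

/-- The two ends of a chord have the same height. The chord preserves the weighted distance `d` from
the puncture that it cuts off. If the two arcs of the triangulation have different measures, then
the weight of the corner is the smallest in the triangle by the tropical triangle inequalities, and
`d`, which is bounded by this weight, is the height of both of the ends. -/
theorem height_eq (hTT : D.TropicalTriangle L.measure) {t : Fin D.n} {k : Fin 3} {a : ℝ × ℝ}
    (ha : a ∈ L.chords (t, k)) :
    L.height ((t, k + 1), 1 - a.2) = L.height ((t, k + 2), a.1) := by
  have hd : L.depth (flip ((t, k + 1), 1 - a.2)) = L.depth ((t, k + 2), a.1) := by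
    rw [depth_flip, depth]
    simp only [measureReal_def, MeasuredLamination.mass_Iio_eq_mass_Ioi ha,
      MeasuredLamination.mass_singleton ha, source, target, Fin.add_one_add_two,
      Fin.add_two_add_one]
  have hle : L.depth ((t, k + 2), a.1) ≤ L.cornerWeight (t, k) := by
    have h := MeasuredLamination.mass_Iio_add_mass_singleton_le ha
    have h' : 0 ≤ (L.mass (t, k + 2)).real {a.1} := measureReal_nonneg
    simp only [depth, cornerWeight, source, Fin.add_two_add_one]
    linarith
  have e1 := L.depth_add_depth_flip ((t, k + 1), 1 - a.2)
  have e2 := L.depth_add_depth_flip ((t, k + 2), a.1)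
  have h1 := hTT t (k + 1)
  have h2 := hTT t (k + 2)
  simp only [measure_edge, Fin.add_one_add_one, Fin.add_one_add_two, Fin.add_two_add_one,
    Fin.add_two_add_two] at e1 e2 h1 h2
  rw [height, height, hd, eq_sub_of_add_eq e1, hd, eq_sub_of_add_eq' e2]
  grind

theorem finite_depth_eq (s : D.Side) (r : ℝ) : {u ∈ L.trace s | L.depth (s, u) = r}.Finite := by
  refine Set.finite_of_forall_not_lt_lt fun x hx y hy z hz hxy hyz => ?_
  -- The point `y` of the support lies between `x` and `z`, so that their depths are distinct.
  have hpos : 0 < (L.mass s).real (Ioo x z) := by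
    refine ENNReal.toReal_pos (ne_of_gt ?_) (measure_ne_top _ _)
    have := hy.1
    rw [← L.support_mass, Measure.mem_support_iff_forall] at this
    exact this _ (Ioo_mem_nhds hxy hyz)
  have hle : (L.mass s).real (Iio x) + (L.mass s).real {x} + (L.mass s).real (Ioo x z) ≤
      (L.mass s).real (Iio z) := by
    rw [← measureReal_union (by simp) (measurableSet_singleton _), Iio_union_right,
      ← measureReal_union ?_ measurableSet_Ioo, Iic_union_Ioo_eq_Iio (hxy.trans hyz)]
    exact (Iic_disjoint_Ioi le_rfl).mono_right Ioo_subset_Ioi_self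
  have h := hx.2.trans hz.2.symm
  have h1 : 0 ≤ (L.mass s).real {x} := measureReal_nonneg
  have h2 : 0 ≤ (L.mass s).real {z} := measureReal_nonneg
  simp only [depth] at h
  linarith

theorem finite_height_eq (s : D.Side) (r : ℝ) : {u ∈ L.trace s | L.height (s, u) = r}.Finite := by
  refine ((L.finite_depth_eq s r).union
    ((L.finite_depth_eq (D.glue s) r).image fun u => 1 - u)).subset ?_
  rintro u ⟨hu, h⟩
  rcases min_choice (L.depth (s, u)) (L.depth (flip (s, u))) with h' | h'
  · exact Or.inl ⟨hu, h'.symm.trans h⟩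
  · refine Or.inr ⟨1 - u, ⟨?_, h'.symm.trans h⟩, sub_sub_cancel 1 u⟩
    rw [L.trace_glue]
    exact mem_image_of_mem _ hu

end DecoratedMeasuredLamination

end IdealTriangulation

theorem lemma2p3 {F : Type*} [TopologicalSpace F] (D : IdealTriangulation F)
    (L : D.DecoratedMeasuredLamination) (μ : D.Edge → ℝ) (hμ : L.measure = μ)
    (hTT : D.TropicalTriangle μ) (S : Set F) (hS : L.IsLeaf S) :
    IsSimpleClosedCurve S := by
  subst hμ
  rcases hS with hS | ⟨p, u, -, hu, rfl, -⟩
  · refine IdealTriangulation.MeasuredLamination.isSimpleClosedCurve_of_isLeaf L.height_flip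
      (fun C => ?_) L.finite_height_eq hS
    obtain ⟨c, a, ha, _ | _⟩ := C
    · exact (L.height_eq hTT ha).symm
    · exact L.height_eq hTT ha
  · exact IdealTriangulation.isSimpleClosedCurve_collar p hu
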